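/- Theorem (normal radius of the cone over a minimal product of oriented real Grassmannians). Let $m\ge 1$ and let $1\le l_i<k_i$ be integers for $1\le i\le m$. Let $M_i=\widetilde G(l_i,k_i;\mathbb R)$ be the Grassmannian of oriented $l_i$-planes in $\mathbb R^{k_i}$, and let $f_i: M_i\to \bigwedge^{l_i}\mathbb R^{k_i}\cong\mathbb R^{\binom{k_i}{l_i}}$ be its Plücker embedding into the unit sphere, which sends an oriented plane to the unit simple vector $b_1\wedge\dots\wedge b_{l_i}$, where $(b_j)$ is any positively oriented orthonormal basis of the plane. Put $\lambda_i=\sqrt{\dim M_i/\sum_{j}\dim M_j}$ with $\dim M_i=l_i(k_i-l_i)$, let $$M=\{(\lambda_1f_1(x_1),\dots,\lambda_mf_m(x_m)) : x_i\in M_i\}\subset\bigoplus_{i=1}^m\textstyle\bigwedge^{l_i}\mathbb R^{k_i}$$ be the minimal product, a submanifold of the unit sphere, and let $C=\{ty: t\ge 0,\ y\in M\}$ be the cone over $M$. Arrange the factors so that $\lambda_1=\min\{\lambda_1,\dots,\lambda_m\}$, and assume that $2\le l_1\le k_1-2$ (that is, the factor $M_1$ of smallest weight is not a sphere). For $p\in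 M$ and $\alpha\ge0$, the $\alpha$-normal wedge of $C$ at $p$ is the union of the open rays from the origin that lie in $\mathbb Rp\oplus (T_pC)^\perp$ and make an angle less than $\alpha$ with $p$; the normal radius of $C$ at $p$ is the largest $\alpha\in[0,\pi]$ such that the $\alpha$-normal wedge at $p$ meets $C$ only in the ray through $p$; the normal radius of $C$ is the infimum of the normal radii over all $p\in M$. Then the normal radius of $C$ is $\arccos(1-\lambda_1^2)$; moreover, the normal radius of $C$ at every point $p\in M$ equals $\arccos(1-\lambda_1^2)$. -/

import Mathlib

open Real Module

noncomputable section

/-! ### Cones and their normal radius -/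

section Cone

variable {V : Type*} [NormedAddCommGroup V] [InnerProductSpace ℝ V]

/-- The cone with vertex at the origin over a subset `M` (its link) of the unit sphere. -/
def coneOver (M : Set V) : Set V :=
  {x | ∃ t : ℝ, 0 ≤ t ∧ ∃ y ∈ M, x = t • y}

/-- The normal space of `C` at `p`: the orthogonal complement of the tangent space of `C` at `p`.
At a point where `C` is an embedded submanifold, `tangentConeAt ℝ C p` is the usual tangent
space. -/
def normalSpace (C : Set V) (p : V) : Submodule ℝ V :=
  (Submodule.span ℝ (tangentConeAt ℝ C p))ᗮ

/-- The `α`-normal wedge of a cone `C` at a unit vector `p ∈ C`: the union of all open rays that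
start at the origin, lie in the linear space spanned by `p` and the normal space of `C` at `p`, and
make an angle less than `α` with `p`. (Equivalently, the open rays through the points of the
geodesics of the unit sphere of length `< α` that start at `p` orthogonally to the link.) -/
def normalWedge (C : Set V) (p : V) (α : ℝ) : Set V :=
  {x | x ≠ 0 ∧ x ∈ Submodule.span ℝ {p} ⊔ normalSpace C p ∧ InnerProductGeometry.angle p x < α}

/-- The open ray from the origin through `p`. -/
def openRay (p : V) : Set V := {x | ∃ t : ℝ, 0 < t ∧ x = t • p}

/-- The normal radius of the cone `C` at `p`: the largest angle `α ∈ [0, π]` such that the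
`α`-normal wedge at `p` meets `C` only in the ray through `p`. -/
def normalRadiusAt (C : Set V) (p : V) : ℝ :=
  sSup {α : ℝ | 0 ≤ α ∧ α ≤ π ∧ normalWedge C p α ∩ C ⊆ openRay p}

/-- The supremum in the definition of the normal radius is a maximum. -/
theorem isGreatest_normalRadiusAt (C : Set V) (p : V) :
    IsGreatest {α : ℝ | 0 ≤ α ∧ α ≤ π ∧ normalWedge C p α ∩ C ⊆ openRay p}
      (normalRadiusAt C p) := by
  have hne : {α : ℝ | 0 ≤ α ∧ α ≤ π ∧ normalWedge C p α ∩ C ⊆ openRay p}.Nonempty :=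
    ⟨0, le_rfl, pi_pos.le, fun x hx =>
      absurd hx.1.2.2 (not_lt.2 (InnerProductGeometry.angle_nonneg p x))⟩
  have hbdd : BddAbove {α : ℝ | 0 ≤ α ∧ α ≤ π ∧ normalWedge C p α ∩ C ⊆ openRay p} :=
    ⟨π, fun α hα => hα.2.1⟩
  have hlub := isLUB_csSup hne hbdd
  refine ⟨⟨?_, hlub.2 fun α hα => hα.2.1, ?_⟩, hlub.1⟩
  · obtain ⟨α, hα⟩ := hne
    exact hα.1.trans (hlub.1 hα)
  · rintro x ⟨⟨hx0, hxN, hxa⟩, hxC⟩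
    obtain ⟨α, hα, hlt⟩ := (lt_isLUB_iff hlub).1 hxa
    exact hα.2.2 ⟨⟨hx0, hxN, hlt⟩, hxC⟩

/-- The normal radius of the cone `C`: the infimum of its normal radii at the points of its link,
the intersection of `C` with the unit sphere. -/
def normalRadius (C : Set V) : ℝ :=
  ⨅ p : (C ∩ Metric.sphere (0 : V) 1 : Set V), normalRadiusAt C (p : V)

end Cone

/-! ### Oriented Grassmannians and their Plücker embedding -/

/-- The oriented real Grassmannian: oriented `l`-dimensional linear subspaces of `ℝ^k`. -/
structure OrientedGrassmannian (l k : ℕ) where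
  /-- the subspace -/
  plane : Submodule ℝ (EuclideanSpace ℝ (Fin k))
  finrank_plane : finrank ℝ plane = l
  /-- its orientation -/
  orientation : Orientation ℝ plane (Fin l)

/-- The Plücker embedding of the oriented Grassmannian into the unit sphere of the Euclidean space
`⋀^l ℝ^k`: an oriented plane is sent to the unit simple `l`-vector `b₁ ∧ ⋯ ∧ b_l`, where `b` is a
positively oriented orthonormal basis of the plane (which one does not matter, see
`pluckerEmbedding_eq`). -/
def pluckerEmbedding {l k : ℕ} (hl : 0 < l) (W : OrientedGrassmannian l k) :
    ⋀[ℝ]^l (EuclideanSpace ℝ (Fin k)) :=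
  exteriorPower.ιMulti ℝ l fun j =>
    (W.orientation.finOrthonormalBasis hl W.finrank_plane j : EuclideanSpace ℝ (Fin k))

theorem norm_ιMulti_orthonormalBasis {l k : ℕ} {P : Submodule ℝ (EuclideanSpace ℝ (Fin k))}
    (b : OrthonormalBasis (Fin l) ℝ P) :
    ‖exteriorPower.ιMulti ℝ l fun j => (b j : EuclideanSpace ℝ (Fin k))‖ = 1 := by
  have h : Matrix.gram ℝ (fun j => (b j : EuclideanSpace ℝ (Fin k))) = 1 :=
    Matrix.gram_eq_one_iff_orthonormal.mpr
      (b.orthonormal.comp_linearIsometry P.subtypeₗᵢ)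
  have h2 := exteriorPower.inner_ιMulti_self (fun j => (b j : EuclideanSpace ℝ (Fin k)))
  rw [h, Matrix.det_one, real_inner_self_eq_norm_sq] at h2
  exact (pow_eq_one_iff_of_nonneg (norm_nonneg _) two_ne_zero).1 h2

theorem pluckerEmbedding_eq {l k : ℕ} (hl : 0 < l) (W : OrientedGrassmannian l k)
    (b : OrthonormalBasis (Fin l) ℝ W.plane) (hb : b.toBasis.orientation = W.orientation) :
    pluckerEmbedding hl W =
      exteriorPower.ιMulti ℝ l fun j => (b j : EuclideanSpace ℝ (Fin k)) := by
  unfold pluckerEmbedding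
  set a := W.orientation.finOrthonormalBasis hl W.finrank_plane with ha
  have hor : b.toBasis.orientation = a.toBasis.orientation := by
    rw [hb, ha, Orientation.finOrthonormalBasis_orientation]
  have hdet := b.det_to_matrix_orthonormalBasis_of_same_orientation a hor
  rw [← inner_eq_one_iff_of_norm_eq_one (𝕜 := ℝ) (norm_ιMulti_orthonormalBasis a)
    (norm_ιMulti_orthonormalBasis b), exteriorPower.inner_ιMulti_ιMulti, ← hdet, Basis.det_apply]
  congr 1
  ext i j
  simp [Basis.toMatrix_apply, b.repr_apply_apply, real_inner_comm]

/-! ### The minimal product -/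

/-- The dimension `l (k - l)` of the oriented Grassmannian of `l`-planes in `ℝ^k`, as a real
number. -/
def grassmannDim (l k : ℕ) : ℝ := (l : ℝ) * ((k : ℝ) - (l : ℝ))

variable {m : ℕ}

/-- The weight `λ_i = √(dim M_i / dim M)` of the `i`-th factor in the minimal product. -/
def weight (l k : Fin m → ℕ) (i : Fin m) : ℝ :=
  √(grassmannDim (l i) (k i) / ∑ j, grassmannDim (l j) (k j))

/-- The Euclidean space `⨁ i, ⋀^(l i) ℝ^(k i)` that contains the product. -/
abbrev ProductSpace (l k : Fin m → ℕ) : Type :=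
  PiLp 2 fun i => ⋀[ℝ]^(l i) (EuclideanSpace ℝ (Fin (k i)))

/-- The minimal product `(x_i) ↦ (λ_i f_i(x_i))` of the Plücker embeddings `f_i`. -/
def minimalProduct (l k : Fin m → ℕ) (hl : ∀ i, 0 < l i)
    (W : ∀ i, OrientedGrassmannian (l i) (k i)) : ProductSpace l k :=
  WithLp.toLp 2 fun i => weight l k i • pluckerEmbedding (hl i) (W i)

/-- The submanifold `M` of the unit sphere: the image of the minimal product. -/
def productLink (l k : Fin m → ℕ) (hl : ∀ i, 0 < l i) : Set (ProductSpace l k) :=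
  Set.range (minimalProduct l k hl)

end

/-! The tangent space of the cone is never computed: explicit circles in the link supply tangent
vectors, and functionals that are second order at `p` on the link supply normal vectors.

Lower bound: if a link point lies in `ℝp ⊕ (T_pC)ᗮ`, each of its factors is orthogonal to the
tangent vectors of that Grassmannian at the corresponding factor of `p`. By
`ιMulti_eq_or_inner_nonpos` such a factor either agrees with that of `p` or has inner product at
most `0` with it. The inner product in the product is the `λ_i²`-weighted mean of those of the
factors, so a single disagreement at `i` costs at least `λ_i² ≥ λ_{i₀}²`.

Sharpness: in the factor `i₀`, replace two vectors of an orthonormal basis of the plane by two unit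
vectors orthogonal to the plane and to each other; this needs `2 ≤ l ≤ k - 2`. The new factor is
orthogonal to the old one, and by the three-term Plücker relation it pairs with the Grassmannian to
second order (`abs_inner_ιMulti_update_update_le`). Hence the new point lies in `ℝp ⊕ (T_pC)ᗮ`, with
inner product exactly `1 - λ_{i₀}²` with `p`. -/

/-! ### Determinants with replaced rows -/

section Determinant

variable {n : ℕ}

/-- Replacing row `i` by a combination of the rows multiplies the determinant by a coefficient. -/
theorem detRowAlternating_update_sum (A : Fin n → Fin n → ℝ) (c : Fin n → ℝ) (i : Fin n) :
    Matrix.detRowAlternating (Function.update A i (∑ r, c r • A r)) =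
      c i * Matrix.detRowAlternating A := by
  rw [AlternatingMap.map_update_sum, Finset.sum_eq_single i]
  · rw [AlternatingMap.map_update_smul, Function.update_eq_self, smul_eq_mul]
  · intro r _ hr
    rw [AlternatingMap.map_update_smul, AlternatingMap.map_update_self _ _ hr.symm, smul_zero]
  · simp

/-- The rows of a matrix with nonzero determinant span. -/
theorem exists_eq_sum_smul_of_det_ne_zero {A : Fin n → Fin n → ℝ}
    (hA : Matrix.detRowAlternating A ≠ 0) (u : Fin n → ℝ) : ∃ c : Fin n → ℝ, u = ∑ r, c r • A r := by
  have hdet : IsUnit (Matrix.det (Matrix.of A)) := isUnit_iff_ne_zero.2 hA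
  refine ⟨Matrix.vecMul u (Matrix.of A)⁻¹, ?_⟩
  have h : Matrix.vecMul (Matrix.vecMul u (Matrix.of A)⁻¹) (Matrix.of A) = u := by
    rw [Matrix.vecMul_vecMul, Matrix.nonsing_inv_mul _ hdet, Matrix.vecMul_one]
  rw [Matrix.vecMul_eq_sum] at h
  exact h.symm

/-- The three-term Plücker relation. -/
theorem detRowAlternating_plucker {A : Fin n → Fin n → ℝ}
    (hA : Matrix.detRowAlternating A ≠ 0) {i j : Fin n} (hij : i ≠ j) (u v : Fin n → ℝ) :
    Matrix.detRowAlternating (Function.update (Function.update A i u) j v) *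
        Matrix.detRowAlternating A =
      Matrix.detRowAlternating (Function.update A i u) *
          Matrix.detRowAlternating (Function.update A j v) -
        Matrix.detRowAlternating (Function.update A j u) *
          Matrix.detRowAlternating (Function.update A i v) := by
  obtain ⟨c, rfl⟩ := exists_eq_sum_smul_of_det_ne_zero hA u
  have key : Matrix.detRowAlternating
      (Function.update (Function.update A i (∑ r, c r • A r)) j v) =
      c i * Matrix.detRowAlternating (Function.update A j v) -
        c j * Matrix.detRowAlternating (Function.update A i v) := by
    -- With `u` expanded in the rows of `A`, only the rows `i` and `j` contribute: any other row
    -- would occur twice. Row `j` contributes with a sign, from swapping it back into place.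
    rw [Function.update_comm hij, AlternatingMap.map_update_sum,
      ← Finset.sum_subset (Finset.subset_univ {i, j}), Finset.sum_pair hij]
    · simp only [AlternatingMap.map_update_smul, smul_eq_mul]
      have h1 : Function.update (Function.update A j v) i (A i) = Function.update A j v := by
        rw [Function.update_comm hij.symm, Function.update_eq_self]
      have h2 : Matrix.detRowAlternating (Function.update (Function.update A j v) i (A j)) =
          -Matrix.detRowAlternating (Function.update A i v) := by
        rw [← AlternatingMap.map_swap _ (Function.update A i v) hij]
        congr 1
        ext r
        by_cases hri : r = i
        · subst hri; simp [hij.symm]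
        · by_cases hrj : r = j
          · subst hrj; simp [hri]
          · simp [hri, hrj, Equiv.swap_apply_of_ne_of_ne]
      rw [h1, h2]
      ring
    · intro r _ hr
      simp only [Finset.mem_insert, Finset.mem_singleton, not_or] at hr
      rw [AlternatingMap.map_update_smul]
      have : Matrix.detRowAlternating (Function.update (Function.update A j v) i (A r)) = 0 := by
        refine AlternatingMap.map_eq_zero_of_eq _ _ ?_ hr.1
        simp [hr.1, hr.2]
      rw [this, smul_zero]
  rw [key, detRowAlternating_update_sum, detRowAlternating_update_sum]
  ring

end Determinant

/-! ### Simple multivectors -/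

section InnerProduct

variable {n : ℕ} {E : Type*} [NormedAddCommGroup E] [InnerProductSpace ℝ E]

theorem inner_eq_one_sub_norm_sub_sq {x y : E} (hx : ‖x‖ = 1) (hy : ‖y‖ = 1) : inner ℝ x y = 1 - ‖x - y‖ ^ 2 / 2 := by
  rw [norm_sub_sq_real, hx, hy]
  ring

/-- Tangent vectors pair with unit vectors to first order in the distance. -/
theorem abs_inner_le_norm_sub {τ x y : E} (hτ : ‖τ‖ = 1) (h : inner ℝ τ x = 0) : |inner ℝ τ y| ≤ ‖x - y‖ := by
  have h2 : inner ℝ τ y = inner ℝ τ (y - x) := by rw [inner_sub_right, h, sub_zero]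
  rw [h2, norm_sub_rev]
  simpa [hτ] using abs_real_inner_le_norm τ (y - x)

theorem Orthonormal.update {a : Fin n → E} (ha : Orthonormal ℝ a) {i : Fin n}
    {v : E} (hv1 : ‖v‖ = 1) (hv : ∀ j, j ≠ i → inner ℝ v (a j) = 0) :
    Orthonormal ℝ (Function.update a i v) := by
  refine ⟨fun r => ?_, fun r s hrs => ?_⟩
  · by_cases h : r = i
    · subst h; simpa using hv1
    · simpa [h] using ha.1 r
  · by_cases h : r = i
    · subst h; simpa [hrs.symm] using hv s hrs.symm
    · by_cases h' : s = i
      · subst h'; simpa [h, real_inner_comm] using hv r h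
      · simpa [h, h'] using ha.2 hrs

theorem Orthonormal.update_cos_sin {a : Fin n → E} (ha : Orthonormal ℝ a) (i : Fin n) {v : E}
    (hv1 : ‖v‖ = 1) (hv : ∀ j, inner ℝ v (a j) = 0) (t : ℝ) :
    Orthonormal ℝ (Function.update a i (cos t • a i + sin t • v)) := by
  refine ha.update ?_ fun j hj => ?_
  · have h : ‖cos t • a i + sin t • v‖ ^ 2 = 1 := by
      rw [norm_add_sq_real, norm_smul, norm_smul, hv1, ha.1 i, real_inner_smul_left,
        real_inner_smul_right, real_inner_comm, hv]
      simp
    exact (pow_eq_one_iff_of_nonneg (norm_nonneg _) two_ne_zero).1 h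
  · rw [inner_add_left, real_inner_smul_left, real_inner_smul_left, hv, ha.2 hj.symm]
    simp

/-- Rotating one vector of a family moves its wedge product along a circle. -/
theorem ιMulti_update_cos_sin (a : Fin n → E) (i : Fin n) (v : E) (t : ℝ) :
    exteriorPower.ιMulti ℝ n (Function.update a i (cos t • a i + sin t • v)) =
      cos t • exteriorPower.ιMulti ℝ n a +
        sin t • exteriorPower.ιMulti ℝ n (Function.update a i v) := by
  rw [AlternatingMap.map_update_add, AlternatingMap.map_update_smul,
    AlternatingMap.map_update_smul, Function.update_eq_self]

end InnerProduct

section Simple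

variable {n : ℕ} {E : Type*} [NormedAddCommGroup E] [InnerProductSpace ℝ E] [FiniteDimensional ℝ E]

theorem inner_ιMulti_eq_detRowAlternating (a b : Fin n → E) :
    inner ℝ (exteriorPower.ιMulti ℝ n a) (exteriorPower.ιMulti ℝ n b) =
      Matrix.detRowAlternating fun i j => inner ℝ (a i) (b j) := by
  rw [exteriorPower.inner_ιMulti_ιMulti, ← Matrix.det_transpose]
  rfl

theorem inner_ιMulti_update (a b : Fin n → E) (i : Fin n) (v : E) :
    inner ℝ (exteriorPower.ιMulti ℝ n (Function.update a i v)) (exteriorPower.ιMulti ℝ n b) =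
      Matrix.detRowAlternating
        (Function.update (fun i j => inner ℝ (a i) (b j)) i fun j => inner ℝ v (b j)) := by
  rw [inner_ιMulti_eq_detRowAlternating]
  congr 1
  ext r s
  by_cases h : r = i
  · subst h; simp
  · simp [h]

theorem inner_ιMulti_update_update (a b : Fin n → E) {i j : Fin n} (u v : E) :
    inner ℝ (exteriorPower.ιMulti ℝ n (Function.update (Function.update a i u) j v))
        (exteriorPower.ιMulti ℝ n b) =
      Matrix.detRowAlternating
        (Function.update (Function.update (fun i j => inner ℝ (a i) (b j)) i
          fun j => inner ℝ u (b j)) j fun j => inner ℝ v (b j)) := by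
  rw [inner_ιMulti_update]
  congr 2
  ext r s
  by_cases h : r = i
  · subst h; simp
  · simp [h]

theorem norm_ιMulti_of_orthonormal {a : Fin n → E} (ha : Orthonormal ℝ a) :
    ‖exteriorPower.ιMulti ℝ n a‖ = 1 := by
  have h := exteriorPower.inner_ιMulti_self a
  rw [Matrix.gram_eq_one_iff_orthonormal.mpr ha, Matrix.det_one, real_inner_self_eq_norm_sq] at h
  exact (pow_eq_one_iff_of_nonneg (norm_nonneg _) two_ne_zero).1 h

theorem inner_ιMulti_update_self {a : Fin n → E} {i : Fin n} {v : E}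
    (hv : ∀ j, inner ℝ v (a j) = 0) :
    inner ℝ (exteriorPower.ιMulti ℝ n (Function.update a i v)) (exteriorPower.ιMulti ℝ n a) = 0 := by
  rw [inner_ιMulti_update]
  refine AlternatingMap.map_coord_zero _ i ?_
  ext j
  simp [hv]

/-- A unit simple vector orthogonal to all tangent vectors of the Grassmannian at a unit simple
vector `a` is `a` itself or makes at least a right angle with `a`. -/
theorem ιMulti_eq_or_inner_nonpos {a b : Fin n → E} (ha : Orthonormal ℝ a) (hb : Orthonormal ℝ b)
    (h : ∀ i, ∀ v : E, ‖v‖ = 1 → (∀ j, inner ℝ v (a j) = 0) →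
      inner ℝ (exteriorPower.ιMulti ℝ n (Function.update a i v)) (exteriorPower.ιMulti ℝ n b) = 0) :
    exteriorPower.ιMulti ℝ n a = exteriorPower.ιMulti ℝ n b ∨
      inner ℝ (exteriorPower.ιMulti ℝ n a) (exteriorPower.ιMulti ℝ n b) ≤ 0 := by
  by_cases hD : Matrix.detRowAlternating (fun i j => inner ℝ (a i) (b j)) = 0
  · right
    rw [inner_ιMulti_eq_detRowAlternating, hD]
  -- Write the row of pairings of `v` with `b` in the rows of the Gram matrix. Replacing row `i`
  -- gives coefficient `i` times the nonzero determinant, so the tangency condition kills every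
  -- coefficient.
  have hperp : ∀ v : E, (∀ j, inner ℝ v (a j) = 0) → ∀ s, inner ℝ v (b s) = 0 := by
    have hunit : ∀ v : E, ‖v‖ = 1 → (∀ j, inner ℝ v (a j) = 0) → ∀ s, inner ℝ v (b s) = 0 := by
      intro v hv1 hv s
      obtain ⟨c, hc⟩ := exists_eq_sum_smul_of_det_ne_zero hD fun j => inner ℝ v (b j)
      have hc0 : ∀ i, c i = 0 := fun i => by
        have := h i v hv1 hv
        rw [inner_ιMulti_update, hc, detRowAlternating_update_sum] at this
        exact (mul_eq_zero.1 this).resolve_right hD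
      simpa [hc0] using congrFun hc s
    intro v hv s
    by_cases hv0 : v = 0
    · simp [hv0]
    · have := hunit (‖v‖⁻¹ • v) (norm_smul_inv_norm (𝕜 := ℝ) hv0)
        (fun j => by rw [real_inner_smul_left, hv, mul_zero]) s
      rw [real_inner_smul_left] at this
      exact (mul_eq_zero.1 this).resolve_left (inv_ne_zero (norm_ne_zero_iff.2 hv0))
  have hsum : ∀ s, b s = ∑ r, inner ℝ (a r) (b s) • a r := by
    intro s
    set w := b s - ∑ r, inner ℝ (a r) (b s) • a r with hw
    have hwa : ∀ j, inner ℝ w (a j) = 0 := fun j => by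
      rw [hw, inner_sub_left, ha.inner_left_fintype, real_inner_comm]
      simp
    have hww : inner ℝ w w = 0 := by
      nth_rewrite 2 [hw]
      rw [inner_sub_right, hperp w hwa s, inner_sum]
      simp [inner_smul_right, hwa]
    exact sub_eq_zero.1 (inner_self_eq_zero.1 hww)
  -- Both families now span the same plane, so the change of basis is orthogonal and its determinant
  -- is `±1`, the sign comparing the orientations.
  have hmul : (Matrix.of fun i j => inner ℝ (a i) (b j)).transpose *
      (Matrix.of fun i j => inner ℝ (a i) (b j)) = 1 := by
    ext s t
    rw [Matrix.mul_apply, Matrix.one_apply, ← orthonormal_iff_ite.1 hb s t]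
    conv_rhs => rw [hsum t, inner_sum]
    refine Finset.sum_congr rfl fun r _ => ?_
    simp [inner_smul_right, real_inner_comm, mul_comm]
  have hsq := congrArg Matrix.det hmul
  rw [Matrix.det_mul, Matrix.det_transpose, Matrix.det_one] at hsq
  rcases mul_self_eq_one_iff.1 hsq with h1 | h1
  · left
    rw [← inner_eq_one_iff_of_norm_eq_one (𝕜 := ℝ) (norm_ιMulti_of_orthonormal ha)
      (norm_ιMulti_of_orthonormal hb), inner_ιMulti_eq_detRowAlternating]
    exact h1
  · right
    rw [inner_ιMulti_eq_detRowAlternating]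
    exact h1.le.trans (by norm_num)

/-- A simple vector obtained from `a` by replacing two vectors by vectors orthogonal to `a` pairs
with the points of the Grassmannian to second order in the distance to `a`. -/
theorem abs_inner_ιMulti_update_update_le {a b : Fin n → E} (ha : Orthonormal ℝ a)
    (hb : Orthonormal ℝ b) {i j : Fin n} (hij : i ≠ j) {u v : E} (hu1 : ‖u‖ = 1) (hv1 : ‖v‖ = 1)
    (hu : ∀ r, inner ℝ u (a r) = 0) (hv : ∀ r, inner ℝ v (a r) = 0) (huv : inner ℝ u v = 0) :
    |inner ℝ (exteriorPower.ιMulti ℝ n (Function.update (Function.update a i u) j v))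
        (exteriorPower.ιMulti ℝ n b)| ≤
      4 * ‖exteriorPower.ιMulti ℝ n a - exteriorPower.ιMulti ℝ n b‖ ^ 2 := by
  set δ := ‖exteriorPower.ιMulti ℝ n a - exteriorPower.ιMulti ℝ n b‖ with hδ
  have hau : ∀ r, Orthonormal ℝ (Function.update a r u) := fun r => ha.update hu1 fun s _ => hu s
  have hav : ∀ r, Orthonormal ℝ (Function.update a r v) := fun r => ha.update hv1 fun s _ => hv s
  have hauv : Orthonormal ℝ (Function.update (Function.update a i u) j v) := by
    refine (hau i).update hv1 fun s _ => ?_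
    by_cases h : s = i
    · subst h; simpa [real_inner_comm] using huv
    · simpa [h] using hv s
  -- Far from `a`, Cauchy–Schwarz suffices. Nearby, the determinant `D = 1 - δ² / 2` is at least
  -- `1/2`, so the Plücker relation can be divided by it; its right side consists of two products of
  -- first-order terms, whence `2 · 2 = 4`.
  rcases le_or_gt 1 (δ ^ 2) with h1 | h1
  · have := abs_real_inner_le_norm
      (exteriorPower.ιMulti ℝ n (Function.update (Function.update a i u) j v))
      (exteriorPower.ιMulti ℝ n b)
    rw [norm_ιMulti_of_orthonormal hauv, norm_ιMulti_of_orthonormal hb] at this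
    linarith
  have hinner := inner_eq_one_sub_norm_sub_sq (norm_ιMulti_of_orthonormal ha)
    (norm_ιMulti_of_orthonormal hb)
  rw [← hδ, inner_ιMulti_eq_detRowAlternating] at hinner
  have hD : (1 : ℝ) / 2 ≤ Matrix.detRowAlternating fun i j => inner ℝ (a i) (b j) := by
    rw [hinner]; linarith
  have hT : ∀ r, ∀ w : E, ‖w‖ = 1 → (∀ s, inner ℝ w (a s) = 0) →
      |Matrix.detRowAlternating (Function.update (fun i j => inner ℝ (a i) (b j)) r
        fun j => inner ℝ w (b j))| ≤ δ := by
    intro r w hw1 hw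
    rw [← inner_ιMulti_update]
    exact abs_inner_le_norm_sub (norm_ιMulti_of_orthonormal (ha.update hw1 fun s _ => hw s))
      (inner_ιMulti_update_self hw)
  have hpl := detRowAlternating_plucker (by linarith : Matrix.detRowAlternating
    (fun i j => inner ℝ (a i) (b j)) ≠ 0) hij (fun j => inner ℝ u (b j)) fun j => inner ℝ v (b j)
  rw [← inner_ιMulti_update_update] at hpl
  set X := inner ℝ (exteriorPower.ιMulti ℝ n (Function.update (Function.update a i u) j v))
        (exteriorPower.ιMulti ℝ n b)
  set D := Matrix.detRowAlternating fun i j => inner ℝ (a i) (b j)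
  have hXD : |X * D| ≤ 2 * δ ^ 2 := by
    rw [hpl]
    refine (abs_sub _ _).trans ?_
    rw [abs_mul, abs_mul]
    have h0 : 0 ≤ δ := norm_nonneg _
    have e1 := mul_le_mul (hT i u hu1 hu) (hT j v hv1 hv) (abs_nonneg _) h0
    have e2 := mul_le_mul (hT j u hu1 hu) (hT i v hv1 hv) (abs_nonneg _) h0
    nlinarith
  rw [abs_mul, abs_of_pos (by linarith : 0 < D)] at hXD
  nlinarith [abs_nonneg X]

end Simple

/-! ### Tangent and normal vectors of cones -/

section Cone

variable {V : Type*} [NormedAddCommGroup V] [InnerProductSpace ℝ V]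

theorem subset_coneOver (M : Set V) : M ⊆ coneOver M :=
  fun y hy => ⟨1, zero_le_one, y, hy, (one_smul ℝ y).symm⟩

theorem coneOver_inter_sphere {M : Set V} (hM : ∀ y ∈ M, ‖y‖ = 1) :
    coneOver M ∩ Metric.sphere (0 : V) 1 = M := by
  ext x
  refine ⟨?_, fun hx => ⟨subset_coneOver M hx, by simpa using hM x hx⟩⟩
  rintro ⟨⟨t, ht, y, hy, rfl⟩, hx⟩
  have h : t = 1 := by simpa [norm_smul, hM y hy, abs_of_nonneg ht] using hx
  simpa [h] using hy

/-- The curve has velocity `d` at `t = 0`. Here `e` may be just the component of `p` that rotates,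
so a single factor of a product can be moved. -/
theorem mem_tangentConeAt_of_circle {C : Set V} {p e d : V}
    (h : ∀ t : ℝ, p + ((cos t - 1) • e + sin t • d) ∈ C) : d ∈ tangentConeAt ℝ C p := by
  have hd : HasDerivAt (fun t : ℝ => p + ((cos t - 1) • e + sin t • d)) d 0 := by
    have := ((((hasDerivAt_cos 0).sub_const 1).smul_const e).add
      ((hasDerivAt_sin 0).smul_const d)).const_add p
    simpa using this
  have hmap := (hd.hasFDerivAt.hasFDerivWithinAt (s := Set.univ)).mapsTo_tangent_cone
    (show (1 : ℝ) ∈ tangentConeAt ℝ Set.univ 0 by rw [tangentConeAt_univ]; trivial)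
  have h0 : p + ((cos 0 - 1) • e + sin 0 • d) = p := by simp
  rw [h0] at hmap
  refine tangentConeAt_mono ?_ (by simpa using hmap)
  rintro _ ⟨t, -, rfl⟩
  exact h t

theorem inner_eq_zero_of_mem_sup_normalSpace {C : Set V} {p d x : V}
    (hx : x ∈ Submodule.span ℝ {p} ⊔ normalSpace C p) (hd : d ∈ tangentConeAt ℝ C p)
    (hpd : inner ℝ p d = 0) : inner ℝ x d = 0 := by
  obtain ⟨y, hy, n, hn, rfl⟩ := Submodule.mem_sup.1 hx
  obtain ⟨c, rfl⟩ := Submodule.mem_span_singleton.1 hy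
  rw [inner_add_left, real_inner_smul_left, hpd, real_inner_comm,
    Submodule.mem_orthogonal _ _ |>.1 hn d (Submodule.subset_span hd)]
  simp

/-- A vector that pairs with the link to second order at `p` is normal to the cone at `p`. -/
theorem mem_normalSpace_of_abs_inner_le {M : Set V} (hM : ∀ y ∈ M, ‖y‖ = 1) {p n : V}
    (hp : p ∈ M) {K : ℝ} (hn : ∀ y ∈ M, |inner ℝ n y| ≤ K * ‖y - p‖ ^ 2) :
    n ∈ normalSpace (coneOver M) p := by
  have hnp : inner ℝ n p = 0 := by simpa using hn p hp
  have hK : ∀ y ∈ M, |inner ℝ n y| ≤ |K| * ‖y - p‖ ^ 2 := fun y hy =>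
    (hn y hy).trans (mul_le_mul_of_nonneg_right (le_abs_self K) (sq_nonneg _))
  -- The estimate passes from the link to the cone: near `p` the radial factor is at most `2`, and
  -- projecting to the link at most doubles the distance to `p`.
  have hbound : ∀ z ∈ coneOver M, ‖z - p‖ < 1 → |inner ℝ n z| ≤ 8 * |K| * ‖z - p‖ ^ 2 := by
    rintro _ ⟨t, ht, y, hy, rfl⟩ hz
    set r := ‖t • y - p‖ with hr
    have ht1 : |t - 1| ≤ r := by
      have := abs_norm_sub_norm_le (t • y) p
      rwa [norm_smul, hM y hy, hM p hp, mul_one, norm_eq_abs, abs_of_nonneg ht] at this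
    have ht2 : t ≤ 2 := by linarith [le_abs_self (t - 1)]
    have hyp : ‖y - p‖ ≤ 2 * r := by
      have : y - p = (t • y - p) - (t - 1) • y := by module
      rw [this]
      refine (norm_sub_le _ _).trans ?_
      rw [norm_smul, hM y hy, norm_eq_abs, mul_one]
      linarith
    rw [real_inner_smul_right, abs_mul, abs_of_nonneg ht]
    calc t * |inner ℝ n y| ≤ 2 * (|K| * ‖y - p‖ ^ 2) :=
          mul_le_mul ht2 (hK y hy) (abs_nonneg _) zero_le_two
      _ ≤ 2 * (|K| * (2 * r) ^ 2) := by gcongr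
      _ = 8 * |K| * r ^ 2 := by ring
  have hzero : HasFDerivWithinAt (innerSL ℝ n : V → ℝ) (0 : V →L[ℝ] ℝ) (coneOver M) p := by
    refine Asymptotics.IsBigO.hasFDerivWithinAt (n := 2) ?_ (subset_coneOver M hp) one_lt_two
    refine Asymptotics.IsBigO.of_bound (8 * |K|) ?_
    filter_upwards [self_mem_nhdsWithin, mem_nhdsWithin_of_mem_nhds (Metric.ball_mem_nhds p one_pos)]
      with z hz hzp
    rw [mem_ball_iff_norm] at hzp
    simpa [innerSL_apply_apply] using hbound z hz hzp
  -- Derivatives within a set agree on its tangent cone, so pairing with `n` vanishes there.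
  have hunique := ((innerSL ℝ n).hasFDerivAt.hasFDerivWithinAt).unique_on hzero
  have hle : Submodule.span ℝ (tangentConeAt ℝ (coneOver M) p) ≤ (Submodule.span ℝ {n})ᗮ := by
    rw [Submodule.span_le]
    intro w hw
    rw [SetLike.mem_coe, Submodule.mem_orthogonal_singleton_iff_inner_right]
    simpa using hunique hw
  rw [normalSpace, Submodule.mem_orthogonal]
  intro w hw
  exact Submodule.mem_orthogonal_singleton_iff_inner_left.1 (hle hw)

/-- If all points of the link, other than `p`, in `ℝp ⊕ (T_pC)ᗮ` have inner product at most
`c` with `p`, and `c < 1` is attained, then the normal radius at `p` is `arccos c`. -/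
theorem normalRadiusAt_eq_arccos {M : Set V} (hM : ∀ y ∈ M, ‖y‖ = 1) {p : V} (hp : p ∈ M) {c : ℝ}
    (hc : c < 1)
    (hle : ∀ y ∈ M, y ∈ Submodule.span ℝ {p} ⊔ normalSpace (coneOver M) p →
      y = p ∨ inner ℝ p y ≤ c)
    (hq : ∃ q ∈ M, q ∈ Submodule.span ℝ {p} ⊔ normalSpace (coneOver M) p ∧ inner ℝ p q = c) :
    normalRadiusAt (coneOver M) p = arccos c := by
  have hangle : ∀ y ∈ M, InnerProductGeometry.angle p y = arccos (inner ℝ p y) := fun y hy => by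
    rw [InnerProductGeometry.angle, hM p hp, hM y hy, mul_one, div_one]
  have hpp : inner ℝ p p = (1 : ℝ) := by rw [real_inner_self_eq_norm_sq, hM p hp, one_pow]
  refine (isGreatest_normalRadiusAt (coneOver M) p).unique
    ⟨⟨arccos_nonneg c, arccos_le_pi c, ?_⟩, ?_⟩
  · rintro x ⟨⟨hx0, hxN, hxa⟩, t, ht, y, hy, rfl⟩
    have ht0 : t ≠ 0 := fun h => hx0 (by rw [h, zero_smul])
    have htpos : 0 < t := lt_of_le_of_ne ht ht0.symm
    rw [InnerProductGeometry.angle_smul_right_of_pos _ _ htpos, hangle y hy] at hxa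
    rw [Submodule.smul_mem_iff _ ht0] at hxN
    rcases hle y hy hxN with rfl | h
    · exact ⟨t, htpos, rfl⟩
    · exact absurd hxa (not_lt.2 (arccos_le_arccos h))
  · rintro α ⟨-, -, hα⟩
    obtain ⟨q, hqM, hqN, hqc⟩ := hq
    by_contra! hlt
    have hq0 : q ≠ 0 := fun h => by simpa [h] using hM q hqM
    obtain ⟨t, ht, htq⟩ := hα ⟨⟨hq0, hqN, by rwa [hangle q hqM, hqc]⟩, subset_coneOver M hqM⟩
    have ht1 : t = 1 := by
      have := hM q hqM
      rwa [htq, norm_smul, hM p hp, mul_one, norm_eq_abs, abs_of_pos ht] at this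
    rw [htq, ht1, one_smul, hpp] at hqc
    exact hc.ne' hqc

end Cone

/-! ### The oriented Grassmannian in terms of orthonormal families -/

section Grassmannian

theorem exists_orthonormal_pluckerEmbedding_eq {l k : ℕ} (hl : 0 < l)
    (W : OrientedGrassmannian l k) : ∃ a : Fin l → EuclideanSpace ℝ (Fin k),
      Orthonormal ℝ a ∧ pluckerEmbedding hl W = exteriorPower.ιMulti ℝ l a :=
  ⟨_, (OrthonormalBasis.orthonormal _).comp_linearIsometry W.plane.subtypeₗᵢ, rfl⟩

/-- Orienting the span of `a` by `a` itself makes every orthonormal family available as a point of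
the Grassmannian. -/
theorem exists_pluckerEmbedding_eq {l k : ℕ} (hl : 0 < l) {a : Fin l → EuclideanSpace ℝ (Fin k)}
    (ha : Orthonormal ℝ a) : ∃ W : OrientedGrassmannian l k,
      pluckerEmbedding hl W = exteriorPower.ιMulti ℝ l a := by
  set b := Basis.span ha.linearIndependent with hb
  have hba : ∀ i, (b i : EuclideanSpace ℝ (Fin k)) = a i := fun i => by
    rw [hb, Basis.span_apply]
  have hbo : Orthonormal ℝ b := by
    rw [← Submodule.subtypeₗᵢ _ |>.orthonormal_comp_iff]
    convert ha using 1
    ext1 i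
    exact hba i
  refine ⟨⟨Submodule.span ℝ (Set.range a), by
    rw [finrank_eq_card_basis b, Fintype.card_fin], b.orientation⟩, ?_⟩
  rw [pluckerEmbedding_eq hl _ (b.toOrthonormalBasis hbo) (by simp)]
  congr 1
  ext1 i
  simpa using hba i

theorem exists_orthonormal_pair_orthogonal {l k : ℕ} (hk : l + 2 ≤ k)
    (a : Fin l → EuclideanSpace ℝ (Fin k)) : ∃ u v : EuclideanSpace ℝ (Fin k),
      ‖u‖ = 1 ∧ ‖v‖ = 1 ∧ inner ℝ u v = 0 ∧ (∀ r, inner ℝ u (a r) = 0) ∧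
        ∀ r, inner ℝ v (a r) = 0 := by
  set P := Submodule.span ℝ (Set.range a)
  have hP : finrank ℝ P ≤ l := by
    have h := finrank_range_le_card (R := ℝ) a
    rwa [Fintype.card_fin] at h
  have hsum := Submodule.finrank_add_finrank_orthogonal P
  rw [finrank_euclideanSpace_fin] at hsum
  have h2 : 2 ≤ finrank ℝ Pᗮ := by omega
  set b := stdOrthonormalBasis ℝ Pᗮ
  have hperp : ∀ (w : Pᗮ) r, inner ℝ (w : EuclideanSpace ℝ (Fin k)) (a r) = 0 := fun w r => by
    rw [real_inner_comm]
    exact (Submodule.mem_orthogonal _ _).1 w.2 _ (Submodule.subset_span (Set.mem_range_self r))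
  refine ⟨b ⟨0, by omega⟩, b ⟨1, by omega⟩, ?_, ?_, ?_, hperp _, hperp _⟩
  · exact b.orthonormal.1 _
  · exact b.orthonormal.1 _
  · exact b.orthonormal.2 (by simp)

theorem norm_pluckerEmbedding {l k : ℕ} (hl : 0 < l) (W : OrientedGrassmannian l k) :
    ‖pluckerEmbedding hl W‖ = 1 :=
  norm_ιMulti_orthonormalBasis _

theorem nonempty_orientedGrassmannian {l k : ℕ} (hl : 0 < l) (hlk : l ≤ k) :
    Nonempty (OrientedGrassmannian l k) := by
  obtain ⟨W, -⟩ := exists_pluckerEmbedding_eq (k := k) hl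
    ((EuclideanSpace.basisFun (Fin k) ℝ).orthonormal.comp (Fin.castLE hlk)
      (Fin.castLE_injective hlk))
  exact ⟨W⟩

end Grassmannian

/-! ### Normal points of the minimal product -/

section Product

variable {m : ℕ} {l k : Fin m → ℕ}

theorem grassmannDim_pos (hl : ∀ i, 0 < l i) (hk : ∀ i, l i < k i) (i : Fin m) :
    0 < grassmannDim (l i) (k i) :=
  mul_pos (by exact_mod_cast hl i) (sub_pos.2 (by exact_mod_cast hk i))

theorem weight_pos (hl : ∀ i, 0 < l i) (hk : ∀ i, l i < k i) (i : Fin m) : 0 < weight l k i :=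
  sqrt_pos.2 (div_pos (grassmannDim_pos hl hk i)
    (Finset.sum_pos (fun j _ => grassmannDim_pos hl hk j) ⟨i, Finset.mem_univ i⟩))

theorem sum_weight_sq (hl : ∀ i, 0 < l i) (hk : ∀ i, l i < k i) (i₀ : Fin m) :
    ∑ i, weight l k i ^ 2 = 1 := by
  have hpos : 0 < ∑ j, grassmannDim (l j) (k j) :=
    Finset.sum_pos (fun j _ => grassmannDim_pos hl hk j) ⟨i₀, Finset.mem_univ i₀⟩
  have h : ∀ i, weight l k i ^ 2 = grassmannDim (l i) (k i) / ∑ j, grassmannDim (l j) (k j) :=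
    fun i => sq_sqrt (div_nonneg (grassmannDim_pos hl hk i).le hpos.le)
  rw [Finset.sum_congr rfl fun i _ => h i, ← Finset.sum_div, div_self hpos.ne']

theorem inner_exteriorPower_smul_left {r d : ℕ} (c : ℝ)
    (x y : ⋀[ℝ]^r (EuclideanSpace ℝ (Fin d))) : inner ℝ (c • x) y = c * inner ℝ x y :=
  real_inner_smul_left x y c

theorem inner_exteriorPower_smul_right {r d : ℕ} (c : ℝ)
    (x y : ⋀[ℝ]^r (EuclideanSpace ℝ (Fin d))) : inner ℝ x (c • y) = c * inner ℝ x y :=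
  real_inner_smul_right x y c

theorem inner_minimalProduct (hl : ∀ i, 0 < l i)
    (W Z : ∀ i, OrientedGrassmannian (l i) (k i)) :
    inner ℝ (minimalProduct l k hl W) (minimalProduct l k hl Z) =
      ∑ i, weight l k i ^ 2 *
        inner ℝ (pluckerEmbedding (hl i) (W i)) (pluckerEmbedding (hl i) (Z i)) := by
  rw [PiLp.inner_apply]
  refine Finset.sum_congr rfl fun i _ => ?_
  simp only [minimalProduct, inner_exteriorPower_smul_left, inner_exteriorPower_smul_right]
  ring

theorem norm_minimalProduct (hl : ∀ i, 0 < l i) (hk : ∀ i, l i < k i) (i₀ : Fin m)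
    (W : ∀ i, OrientedGrassmannian (l i) (k i)) : ‖minimalProduct l k hl W‖ = 1 := by
  have h := inner_minimalProduct hl W W
  simp only [real_inner_self_eq_norm_sq, norm_pluckerEmbedding, one_pow, mul_one,
    sum_weight_sq hl hk i₀] at h
  exact (pow_eq_one_iff_of_nonneg (norm_nonneg _) two_ne_zero).1 h

theorem inner_minimalProduct_single (hl : ∀ i, 0 < l i)
    (W : ∀ i, OrientedGrassmannian (l i) (k i)) (i : Fin m)
    (τ : ⋀[ℝ]^(l i) (EuclideanSpace ℝ (Fin (k i)))) :
    inner ℝ (minimalProduct l k hl W) (WithLp.toLp 2 (Pi.single i τ) : ProductSpace l k) =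
      weight l k i * inner ℝ (pluckerEmbedding (hl i) (W i)) τ := by
  rw [PiLp.inner_apply, Finset.sum_eq_single i]
  · simp [minimalProduct, inner_exteriorPower_smul_left]
  · intro j _ hj
    simp [hj]
  · simp

/-- Tangent vectors of one factor are tangent to the cone over the product. -/
theorem single_mem_tangentConeAt (hl : ∀ i, 0 < l i) (W : ∀ i, OrientedGrassmannian (l i) (k i))
    (i : Fin m) {a : Fin (l i) → EuclideanSpace ℝ (Fin (k i))} (ha : Orthonormal ℝ a)
    (hW : pluckerEmbedding (hl i) (W i) = exteriorPower.ιMulti ℝ (l i) a) (r : Fin (l i))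
    {v : EuclideanSpace ℝ (Fin (k i))} (hv1 : ‖v‖ = 1) (hv : ∀ j, inner ℝ v (a j) = 0) :
    (WithLp.toLp 2 (Pi.single i (weight l k i •
        exteriorPower.ιMulti ℝ (l i) (Function.update a r v))) : ProductSpace l k) ∈
      tangentConeAt ℝ (coneOver (productLink l k hl)) (minimalProduct l k hl W) := by
  refine mem_tangentConeAt_of_circle
    (e := WithLp.toLp 2 (Pi.single i (weight l k i • exteriorPower.ιMulti ℝ (l i) a)))
    fun t => subset_coneOver _ ?_
  obtain ⟨Z, hZ⟩ := exists_pluckerEmbedding_eq (hl i) (ha.update_cos_sin r hv1 hv t)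
  refine ⟨Function.update W i Z, ?_⟩
  rw [ιMulti_update_cos_sin] at hZ
  ext1 j
  by_cases h : j = i
  · subst h
    simp only [minimalProduct, Function.update_self, hZ, hW, PiLp.add_apply, PiLp.smul_apply,
      Pi.single_eq_same]
    module
  · simp [minimalProduct, h]

/-- Normal points of the link lie outside of a ball of angular radius `arccos (1 - λ²)`. -/
theorem eq_or_inner_minimalProduct_le (hl : ∀ i, 0 < l i) (hk : ∀ i, l i < k i)
    {i₀ : Fin m} (hmin : ∀ i, weight l k i₀ ≤ weight l k i)
    {W Z : ∀ i, OrientedGrassmannian (l i) (k i)}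
    (hZ : minimalProduct l k hl Z ∈ Submodule.span ℝ {minimalProduct l k hl W} ⊔
      normalSpace (coneOver (productLink l k hl)) (minimalProduct l k hl W)) :
    minimalProduct l k hl Z = minimalProduct l k hl W ∨
      inner ℝ (minimalProduct l k hl W) (minimalProduct l k hl Z) ≤ 1 - weight l k i₀ ^ 2 := by
  have hfactor : ∀ i, pluckerEmbedding (hl i) (W i) = pluckerEmbedding (hl i) (Z i) ∨
      inner ℝ (pluckerEmbedding (hl i) (W i)) (pluckerEmbedding (hl i) (Z i)) ≤ 0 := by
    intro i
    obtain ⟨a, ha, hWa⟩ := exists_orthonormal_pluckerEmbedding_eq (hl i) (W i)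
    obtain ⟨b, hb, hZb⟩ := exists_orthonormal_pluckerEmbedding_eq (hl i) (Z i)
    rw [hWa, hZb]
    refine ιMulti_eq_or_inner_nonpos ha hb fun r v hv1 hv => ?_
    have h := inner_eq_zero_of_mem_sup_normalSpace hZ
      (single_mem_tangentConeAt hl W i ha hWa r hv1 hv) (by
        rw [inner_minimalProduct_single, hWa, inner_exteriorPower_smul_right, real_inner_comm,
          inner_ιMulti_update_self hv, mul_zero, mul_zero])
    rw [inner_minimalProduct_single, hZb, inner_exteriorPower_smul_right, real_inner_comm] at h
    have hw := (weight_pos hl hk i).ne'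
    exact (mul_eq_zero.1 ((mul_eq_zero.1 h).resolve_left hw)).resolve_left hw
  by_cases hall : ∀ i, pluckerEmbedding (hl i) (W i) = pluckerEmbedding (hl i) (Z i)
  · left
    simp only [minimalProduct, hall]
  · right
    push Not at hall
    obtain ⟨i, hi⟩ := hall
    -- One disagreeing factor is enough; all the others are bounded trivially by `1`.
    have hle : ∀ j, inner ℝ (pluckerEmbedding (hl j) (W j)) (pluckerEmbedding (hl j) (Z j)) ≤
        1 - if j = i then (1 : ℝ) else 0 := by
      intro j
      by_cases h : j = i
      · subst h
        simpa using (hfactor j).resolve_left hi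
      · have := real_inner_le_norm (pluckerEmbedding (hl j) (W j)) (pluckerEmbedding (hl j) (Z j))
        simpa [h, norm_pluckerEmbedding] using this
    rw [inner_minimalProduct]
    calc ∑ j, weight l k j ^ 2 *
          inner ℝ (pluckerEmbedding (hl j) (W j)) (pluckerEmbedding (hl j) (Z j))
        ≤ ∑ j, weight l k j ^ 2 * (1 - if j = i then (1 : ℝ) else 0) :=
          Finset.sum_le_sum fun j _ => mul_le_mul_of_nonneg_left (hle j) (sq_nonneg _)
      _ = 1 - weight l k i ^ 2 := by
          simp [mul_sub, Finset.sum_sub_distrib, sum_weight_sq hl hk i]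
      _ ≤ 1 - weight l k i₀ ^ 2 :=
          sub_le_sub_left (pow_le_pow_left₀ (weight_pos hl hk i₀).le (hmin i) 2) 1

/-- If the factor `i₀` is not a sphere, some normal point of the link has distance exactly
`arccos (1 - λ²)`. -/
theorem exists_normal_inner_eq (hl : ∀ i, 0 < l i) (hk : ∀ i, l i < k i) {i₀ : Fin m}
    (hl₀ : 2 ≤ l i₀) (hk₀ : l i₀ + 2 ≤ k i₀) (W : ∀ i, OrientedGrassmannian (l i) (k i)) :
    ∃ q ∈ productLink l k hl,
      q ∈ Submodule.span ℝ {minimalProduct l k hl W} ⊔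
          normalSpace (coneOver (productLink l k hl)) (minimalProduct l k hl W) ∧
        inner ℝ (minimalProduct l k hl W) q = 1 - weight l k i₀ ^ 2 := by
  obtain ⟨a, ha, hWa⟩ := exists_orthonormal_pluckerEmbedding_eq (hl i₀) (W i₀)
  obtain ⟨u, v, hu1, hv1, huv, hu, hv⟩ := exists_orthonormal_pair_orthogonal hk₀ a
  have hij : (⟨0, by omega⟩ : Fin (l i₀)) ≠ ⟨1, by omega⟩ := by simp
  set i : Fin (l i₀) := ⟨0, by omega⟩
  set j : Fin (l i₀) := ⟨1, by omega⟩
  have hauv : Orthonormal ℝ (Function.update (Function.update a i u) j v) := by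
    refine (ha.update hu1 fun s _ => hu s).update hv1 fun s _ => ?_
    by_cases h : s = i
    · subst h; simpa [real_inner_comm] using huv
    · simpa [h] using hv s
  obtain ⟨Q, hQ⟩ := exists_pluckerEmbedding_eq (hl i₀) hauv
  have hsecond : ∀ Y : OrientedGrassmannian (l i₀) (k i₀),
      |inner ℝ (pluckerEmbedding (hl i₀) Q) (pluckerEmbedding (hl i₀) Y)| ≤
        4 * ‖pluckerEmbedding (hl i₀) (W i₀) - pluckerEmbedding (hl i₀) Y‖ ^ 2 := fun Y => by
    obtain ⟨b, hb, hYb⟩ := exists_orthonormal_pluckerEmbedding_eq (hl i₀) Y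
    rw [hQ, hYb, hWa]
    exact abs_inner_ιMulti_update_update_le ha hb hij hu1 hv1 hu hv huv
  set c := weight l k i₀ ^ 2 with hc
  set p := minimalProduct l k hl W with hp
  set q := minimalProduct l k hl (Function.update W i₀ Q) with hq
  have hp1 : ‖p‖ = 1 := norm_minimalProduct hl hk i₀ W
  have hinner : ∀ Z, inner ℝ q (minimalProduct l k hl Z) =
      inner ℝ p (minimalProduct l k hl Z) + c *
        (inner ℝ (pluckerEmbedding (hl i₀) Q) (pluckerEmbedding (hl i₀) (Z i₀)) -
          inner ℝ (pluckerEmbedding (hl i₀) (W i₀)) (pluckerEmbedding (hl i₀) (Z i₀))) := by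
    intro Z
    rw [← sub_eq_iff_eq_add', hq, hp, inner_minimalProduct, inner_minimalProduct,
      ← Finset.sum_sub_distrib, Finset.sum_eq_single i₀]
    · rw [Function.update_self]; ring
    · intro s _ hs
      rw [Function.update_of_ne hs, sub_self]
    · simp
  have hpq : inner ℝ p q = 1 - c := by
    -- At zero distance the second-order bound says that the new factor is orthogonal to the old
    -- one.
    have hQW := hsecond (W i₀)
    rw [sub_self, norm_zero, zero_pow two_ne_zero, mul_zero, abs_nonpos_iff] at hQW
    rw [real_inner_comm, hinner W, hQW, ← hp, real_inner_self_eq_norm_sq,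
      real_inner_self_eq_norm_sq, hp1, norm_pluckerEmbedding]
    ring
  refine ⟨q, Set.mem_range_self _, ?_, hpq⟩
  have hmem : q - (1 - c) • p ∈ normalSpace (coneOver (productLink l k hl)) p := by
    -- Since `c * δ ^ 2 ≤ ‖y - p‖ ^ 2` and `c ≤ 1`, the three terms of `hval` contribute at most
    -- `4`, `1/2` and `1/2`.
    refine mem_normalSpace_of_abs_inner_le (K := 5) ?_ (Set.mem_range_self _) ?_
    · rintro _ ⟨Z, rfl⟩
      exact norm_minimalProduct hl hk i₀ Z
    rintro _ ⟨Z, rfl⟩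
    set y := minimalProduct l k hl Z
    have hy1 : ‖y‖ = 1 := norm_minimalProduct hl hk i₀ Z
    set δ := ‖pluckerEmbedding (hl i₀) (W i₀) - pluckerEmbedding (hl i₀) (Z i₀)‖
    have hδ : c * δ ^ 2 ≤ ‖y - p‖ ^ 2 := by
      rw [PiLp.norm_sq_eq_of_L2]
      refine le_trans (le_of_eq ?_)
        (Finset.single_le_sum (fun s _ => sq_nonneg ‖(y - p) s‖) (Finset.mem_univ i₀))
      have : (y - p) i₀ = weight l k i₀ •
          (pluckerEmbedding (hl i₀) (Z i₀) - pluckerEmbedding (hl i₀) (W i₀)) := by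
        rw [smul_sub]; rfl
      rw [this, norm_smul, norm_eq_abs, mul_pow, sq_abs, norm_sub_rev]
    have hs := inner_eq_one_sub_norm_sub_sq (norm_pluckerEmbedding (hl i₀) (W i₀))
      (norm_pluckerEmbedding (hl i₀) (Z i₀))
    have hpy := inner_eq_one_sub_norm_sub_sq hp1 hy1
    have hQZ := abs_le.1 (hsecond (Z i₀))
    have hc0 : 0 ≤ c := sq_nonneg _
    have hc1 : c ≤ 1 := by
      rw [← sum_weight_sq hl hk i₀]
      exact Finset.single_le_sum (f := fun s => weight l k s ^ 2) (fun s _ => sq_nonneg _)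
        (Finset.mem_univ i₀)
    have hval : inner ℝ (q - (1 - c) • p) y = c *
        inner ℝ (pluckerEmbedding (hl i₀) Q) (pluckerEmbedding (hl i₀) (Z i₀)) +
          c * δ ^ 2 / 2 - c * (‖y - p‖ ^ 2 / 2) := by
      have hsmul : inner ℝ ((1 - c) • p) y = (1 - c) * inner ℝ p y :=
        real_inner_smul_left p y (1 - c)
      rw [inner_sub_left, hsmul, hinner Z, hs, hpy, norm_sub_rev p y]
      ring
    have h1 := mul_le_mul_of_nonneg_left hQZ.1 hc0
    have h2 := mul_le_mul_of_nonneg_left hQZ.2 hc0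
    have h3 := mul_le_mul_of_nonneg_right hc1 (sq_nonneg ‖y - p‖)
    have h4 : 0 ≤ c * δ ^ 2 := mul_nonneg hc0 (sq_nonneg _)
    have h5 : 0 ≤ c * ‖y - p‖ ^ 2 := mul_nonneg hc0 (sq_nonneg _)
    rw [hval, abs_le]
    constructor <;> linarith
  have hsplit : q = (1 - c) • p + (q - (1 - c) • p) := by abel
  rw [hsplit]
  exact Submodule.add_mem_sup (Submodule.smul_mem _ _ (Submodule.mem_span_singleton_self p)) hmem

end Product

theorem mainTheorem6 {m : ℕ} (l k : Fin m → ℕ) (hl : ∀ i, 0 < l i) (hk : ∀ i, l i < k i)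
    (i₀ : Fin m) (hmin : ∀ i, weight l k i₀ ≤ weight l k i)
    (hl₀ : 2 ≤ l i₀) (hk₀ : l i₀ + 2 ≤ k i₀) :
    normalRadius (coneOver (productLink l k hl)) = arccos (1 - weight l k i₀ ^ 2) ∧
      ∀ p ∈ productLink l k hl,
        normalRadiusAt (coneOver (productLink l k hl)) p = arccos (1 - weight l k i₀ ^ 2) := by
  have hM : ∀ y ∈ productLink l k hl, ‖y‖ = 1 := by
    rintro _ ⟨Z, rfl⟩
    exact norm_minimalProduct hl hk i₀ Z
  have hpoint : ∀ p ∈ productLink l k hl,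
      normalRadiusAt (coneOver (productLink l k hl)) p = arccos (1 - weight l k i₀ ^ 2) := by
    rintro _ ⟨W, rfl⟩
    refine normalRadiusAt_eq_arccos hM (Set.mem_range_self W)
      (sub_lt_self 1 (pow_pos (weight_pos hl hk i₀) 2)) ?_ (exists_normal_inner_eq hl hk hl₀ hk₀ W)
    rintro _ ⟨Z, rfl⟩ hZ
    exact eq_or_inner_minimalProduct_le hl hk hmin hZ
  refine ⟨?_, hpoint⟩
  -- The infimum of a constant is that constant only over a nonempty index type.
  have hne : Nonempty (productLink l k hl) := by
    exact ⟨_, Set.mem_range_self fun i =>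
      (nonempty_orientedGrassmannian (hl i) (hk i).le).some⟩
  rw [normalRadius, coneOver_inter_sphere hM]
  exact (iInf_congr fun p : productLink l k hl => hpoint (p : ProductSpace l k) p.2).trans
    ciInf_const
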